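/- Let $k,n\ge 1$ be integers, $0<\alpha<n$, $0<\gamma<\min\{\frac{k}{n-\alpha},1\}$ and $\varrho>0$. Let $\mathcal{B}^\gamma_\varrho$ be the set of all maps $X:[0,1]^k\to\mathbb{R}^n$ with $X(0)=0$ and $\sup_{s\neq t}\frac{|X(t)-X(s)|}{|t-s|^\gamma}\le\varrho$. For $X\in\mathcal{B}^\gamma_\varrho$ let $\mu_X$ be its occupation measure, $\mu_X(B)=\mathcal{L}^k(\{t\in[0,1]^k: X(t)\in B\})$ for Borel $B\subset\mathbb{R}^n$, and let $$I^\alpha(\mu_X)=\int_{\mathbb{R}^n}\int_{\mathbb{R}^n}|x-y|^{\alpha-n}\,\mu_X(dy)\,\mu_X(dx)=\int_{[0,1]^k}\int_{[0,1]^k}|X(t)-X(s)|^{\alpha-n}\,ds\,dt\in[0,\infty]$$ be its Riesz energy, where $|0|^{\alpha-n}=+\infty$. Write $\mathcal{H}^d$ for the $d$-dimensional Hausdorff measure and $\dim_H$ for the Hausdorff dimension. (i) There is some $X^\ast\in\mathcal{B}^\gamma_\varrho$ minimizing $X\mapsto I^\alpha(\mu_X)$ over $\mathcal{B}^\gamma_\varrho$,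 and the minimum is finite. (ii) For any minimizer $X^\ast$ of $X\mapsto I^\alpha(\mu_X)$ in $\mathcal{B}^\gamma_\varrho$ and any rectangle $\mathcal{R}\subset[0,1]^k$ (a product of $k$ nondegenerate intervals) the image $X^\ast(\mathcal{R})$ satisfies $$\mathcal{H}^{n-\alpha}(X^\ast(\mathcal{R}))=+\infty,\qquad \mathcal{H}^{\min\{k/\gamma,\,n\}}(X^\ast(\mathcal{R}))<+\infty,$$ and, as a consequence, $$n-\alpha\le\dim_H X^\ast(\mathcal{R})\le\min\{k/\gamma,\,n\}.$$ -/

import Mathlib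

open MeasureTheory Set
open scoped NNReal ENNReal

/-- The closed unit cube `[0,1]^k` in Euclidean `k`-space. -/
def unitCube (k : ℕ) : Set (EuclideanSpace ℝ (Fin k)) :=
  {t | ∀ i, t i ∈ Icc (0 : ℝ) 1}

theorem zero_mem_unitCube (k : ℕ) : (0 : EuclideanSpace ℝ (Fin k)) ∈ unitCube k :=
  fun _ => ⟨le_rfl, zero_le_one⟩

/-- The Riesz kernel `|x|^(α-n)` of order `α` on `ℝⁿ`, with values in `[0,∞]`.
For `α < n` the exponent is negative, and the value at the origin is `∞`. -/
noncomputable def rieszKernel {n : ℕ} (α : ℝ) (x : EuclideanSpace ℝ (Fin n)) : ℝ≥0∞ :=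
  ‖x‖ₑ ^ (α - n)

/-- The Riesz potential of order `α` of a measure on `ℝⁿ`. -/
noncomputable def rieszPotential {n : ℕ} (α : ℝ) (μ : Measure (EuclideanSpace ℝ (Fin n)))
    (x : EuclideanSpace ℝ (Fin n)) : ℝ≥0∞ :=
  ∫⁻ y, rieszKernel α (x - y) ∂μ

/-- The mutual Riesz energy of order `α` of two measures on `ℝⁿ`. -/
noncomputable def mutualRieszEnergy {n : ℕ} (α : ℝ)
    (μ ν : Measure (EuclideanSpace ℝ (Fin n))) : ℝ≥0∞ :=
  ∫⁻ x, rieszPotential α μ x ∂ν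

/-- The Riesz self-energy of order `α` of a measure on `ℝⁿ`. -/
noncomputable def rieszEnergy {n : ℕ} (α : ℝ)
    (μ : Measure (EuclideanSpace ℝ (Fin n))) : ℝ≥0∞ :=
  mutualRieszEnergy α μ μ

/-- The `k`-dimensional Lebesgue measure on the unit cube `[0,1]^k`. -/
noncomputable def cubeMeasure (k : ℕ) : Measure (unitCube k) :=
  Measure.comap Subtype.val volume

theorem cubeMeasure_univ (k : ℕ) : cubeMeasure k univ = 1 := by
  have e : unitCube k = (MeasurableEquiv.toLp 2 (Fin k → ℝ)).symm ⁻¹' Icc 0 1 := by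
    ext t; simp [unitCube, Pi.le_def, forall_and]
  have hm : MeasurableSet (unitCube k) := by
    rw [e]; exact MeasurableEquiv.measurable _ measurableSet_Icc
  rw [cubeMeasure, comap_subtype_coe_apply hm]
  simp only [image_univ, Subtype.range_coe]
  rw [e, (EuclideanSpace.volume_preserving_symm_measurableEquiv_toLp (Fin k)).measure_preimage
    measurableSet_Icc.nullMeasurableSet, Real.volume_Icc_pi]
  simp

/-- The occupation measure of a Borel map `X : [0,1]^k → ℝⁿ`: the image under `X` of
`k`-dimensional Lebesgue measure on the unit cube. -/
noncomputable def occupationMeasure {k n : ℕ} (X : unitCube k → EuclideanSpace ℝ (Fin n)) :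
    Measure (EuclideanSpace ℝ (Fin n)) :=
  Measure.map X (cubeMeasure k)

/-- The closed ball of radius `ρ` in the space of `γ`-Hölder maps `X : [0,1]^k → ℝⁿ` with
`X 0 = 0`, normed by the smallest Hölder constant. -/
def holderBall (k n : ℕ) (γ ρ : ℝ≥0) : Set (unitCube k → EuclideanSpace ℝ (Fin n)) :=
  {X | X ⟨0, zero_mem_unitCube k⟩ = 0 ∧ eHolderNorm γ X ≤ ρ}

/-- A (nondegenerate) rectangle in `ℝ^k`: a product of `k` intervals, open, closed or half-open,
each with more than one point. -/
def IsRectangle {k : ℕ} (R : Set (EuclideanSpace ℝ (Fin k))) : Prop :=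
  ∃ J : Fin k → Set ℝ, (∀ i, (J i).OrdConnected ∧ (J i).Nontrivial) ∧ R = {t | ∀ i, t i ∈ J i}

/-- The self-energy of an occupation measure as a double integral over the unit cube. -/
theorem rieszEnergy_occupationMeasure {k n : ℕ} (α : ℝ)
    (X : unitCube k → EuclideanSpace ℝ (Fin n)) (hX : Measurable X) :
    rieszEnergy α (occupationMeasure X) =
      ∫⁻ t, ∫⁻ s, ‖X t - X s‖ₑ ^ (α - n) ∂cubeMeasure k ∂cubeMeasure k := by
  have hv : IsFiniteMeasure (cubeMeasure k) := ⟨by rw [cubeMeasure_univ]; exact ENNReal.one_lt_top⟩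
  have hk : Measurable fun p : EuclideanSpace ℝ (Fin n) × EuclideanSpace ℝ (Fin n) =>
      rieszKernel α (p.1 - p.2) := by
    unfold rieszKernel
    fun_prop
  unfold rieszEnergy mutualRieszEnergy rieszPotential occupationMeasure
  rw [lintegral_map (hk.lintegral_prod_right') hX]
  refine lintegral_congr fun t => ?_
  exact lintegral_map (hk.comp measurable_prodMk_left) hX

/-! Existence is the direct method: the Hölder ball is compact for uniform convergence by
Arzelà–Ascoli, and Fatou's lemma makes the energy lower semicontinuous
(`exists_isMinOn_rieszEnergy`).

Finiteness of the minimum comes from a random competitor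
(`exists_mem_holderBall_rieszEnergy_lt_top`). Fix γ < H < k/(n-α) and take a lacunary trigonometric
series with amplitudes of order 2^(-Hj) and vector coefficients independent and uniform in the unit
cube. After scaling, every realization lies in the Hölder ball. For t ≠ s some single wave has an
increment at least of order |t-s|^H; averaging over its coefficient alone, whatever the others are,
bounds the mean of |X(t)-X(s)|^(α-n) by a multiple of |t-s|^(-H(n-α)). This is integrable since
H(n-α) < k, so some realization has finite energy.

The lower bound uses only that a minimizer has finite energy. The potential is then finite almost
everywhere, the upper (n-α)-density vanishes there, and the occupation measure ignores sets of
finite (n-α)-dimensional Hausdorff measure (`measure_eq_zero_of_rieszEnergy_lt_top`); yet it gives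
the image of a rectangle at least the rectangle's volume. The upper bound uses only Hölder
continuity. -/

/-! ### Finite energy, densities and Hausdorff measure -/

open Filter Topology in
/-- If a finite measure has finite Riesz `d`-potential at `x`, then its upper `d`-density at `x`
vanishes. -/
theorem exists_measure_closedEBall_le_of_lintegral_edist_rpow {X : Type*} [EMetricSpace X]
    [MeasurableSpace X] [BorelSpace X] {μ : Measure X} [IsFiniteMeasure μ] {d : ℝ} (hd : 0 < d)
    {x : X} (h : ∫⁻ y, edist x y ^ (-d) ∂μ ≠ ∞) {ε : ℝ≥0∞} (hε : 0 < ε) :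
    ∃ δ > 0, ∀ r ≤ δ, μ (Metric.closedEBall x r) ≤ ε * r ^ d := by
  have hm : Measurable fun y => edist x y ^ (-d) := by fun_prop
  have hx : μ {x} = 0 := by
    by_contra hne
    refine h (top_unique ?_)
    calc (∞ : ℝ≥0∞) = ∫⁻ y in {x}, edist x y ^ (-d) ∂μ := by
          rw [setLIntegral_congr_fun (g := fun _ => ∞) (measurableSet_singleton x)]
          · simp [ENNReal.top_mul hne]
          · rintro y rfl
            simp [hd]
      _ ≤ _ := setLIntegral_le_lintegral _ _
  -- Absolute continuity of the integral: small balls around the null point `x` carry at most `ε` of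
  -- the potential.
  obtain ⟨η, hη, hη'⟩ := exists_pos_setLIntegral_lt_of_measure_lt h hε.ne'
  have hlim : Tendsto (fun m : ℕ => μ (Metric.closedEBall x ((m : ℝ≥0∞)⁻¹))) atTop (𝓝 0) := by
    have hI : ⋂ m : ℕ, Metric.closedEBall x ((m : ℝ≥0∞)⁻¹) = {x} := by
      ext y
      simp only [mem_iInter, Metric.mem_closedEBall, mem_singleton_iff]
      constructor
      · intro hy
        have : edist y x ≤ 0 := ge_of_tendsto' ENNReal.tendsto_inv_nat_nhds_zero hy
        simpa using this
      · rintro rfl m; simp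
    rw [← hx, ← hI]
    refine tendsto_measure_iInter_atTop
      (fun m => Metric.isClosed_closedEBall.measurableSet.nullMeasurableSet) ?_
      ⟨0, measure_ne_top _ _⟩
    intro m m' hmm
    exact Metric.closedEBall_subset_closedEBall (ENNReal.inv_le_inv.2 (by exact_mod_cast hmm))
  obtain ⟨m, hm'⟩ := (hlim.eventually (gt_mem_nhds hη)).exists
  refine ⟨(m : ℝ≥0∞)⁻¹, by simp, fun r hr => ?_⟩
  rcases eq_or_ne r 0 with rfl | hr0
  · rw [Metric.closedEBall_zero, hx]; exact zero_le
  rcases eq_or_ne r ∞ with rfl | hrt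
  · rw [ENNReal.top_rpow_of_pos hd, ENNReal.mul_top hε.ne']; exact le_top
  have h1 : r ^ (-d) * μ (Metric.closedEBall x r) ≤ ε :=
    calc r ^ (-d) * μ (Metric.closedEBall x r)
        = ∫⁻ _ in Metric.closedEBall x r, r ^ (-d) ∂μ := by simp
      _ ≤ ∫⁻ y in Metric.closedEBall x r, edist x y ^ (-d) ∂μ := by
          refine setLIntegral_mono hm fun y hy => ?_
          rw [Metric.mem_closedEBall'] at hy
          rw [ENNReal.rpow_neg, ENNReal.rpow_neg, ENNReal.inv_le_inv]
          exact ENNReal.rpow_le_rpow hy hd.le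
      _ ≤ ε := (hη' _ ((measure_mono
          (Metric.closedEBall_subset_closedEBall hr)).trans_lt hm')).le
  calc μ (Metric.closedEBall x r) = r ^ d * (r ^ (-d) * μ (Metric.closedEBall x r)) := by
        rw [← mul_assoc, ← ENNReal.rpow_add _ _ hr0 hrt]; simp
    _ ≤ r ^ d * ε := by gcongr
    _ = ε * r ^ d := mul_comm _ _

/-- A measure whose upper `d`-density vanishes almost everywhere does not charge sets of finite
`d`-dimensional Hausdorff measure. -/
theorem measure_eq_zero_of_hausdorffMeasure_ne_top {X : Type*} [EMetricSpace X]
    [MeasurableSpace X] [BorelSpace X] {μ : Measure X} {d : ℝ}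
    (h : ∀ᵐ x ∂μ, ∀ ε : ℝ≥0∞, 0 < ε → ∃ δ > 0, ∀ r ≤ δ, μ (Metric.closedEBall x r) ≤ ε * r ^ d)
    {A : Set X} (hA : μH[d] A ≠ ∞) : μ A = 0 := by
  have key : ∀ ε : ℝ≥0, 0 < ε → μ A ≤ ε * μH[d] A := by
    intro ε hε
    have hε0 : (ε : ℝ≥0∞) ≠ 0 := by exact_mod_cast hε.ne'
    -- On `S m` the density bound holds up to the uniform scale 1/m, so the mass distribution
    -- principle applies there.
    let S : ℕ → Set X := fun m =>
      {x | ∀ r ≤ ((m : ℝ≥0∞)⁻¹), μ (Metric.closedEBall x r) ≤ ε * r ^ d}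
    have hS : Monotone S := fun m m' hmm x hx r hr =>
      hx r (hr.trans (ENNReal.inv_le_inv.2 (by exact_mod_cast hmm)))
    have hfull : ∀ᵐ x ∂μ, x ∈ ⋃ m, S m := by
      filter_upwards [h] with x hx
      obtain ⟨δ, hδ, hδ'⟩ := hx ε (by exact_mod_cast hε)
      obtain ⟨m, hm⟩ := ENNReal.exists_inv_nat_lt hδ.ne'
      exact mem_iUnion.2 ⟨m, fun r hr => hδ' r (hr.trans hm.le)⟩
    have hle : ∀ m, μ (A ∩ S m) ≤ ε * μH[d] A := by
      intro m
      have h1 : (ε : ℝ≥0∞)⁻¹ • μ.restrict (S m) ≤ μH[d] := by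
        refine Measure.le_hausdorffMeasure d _ ((m : ℝ≥0∞)⁻¹) (by simp) fun s hs => ?_
        have h2 : μ.restrict (S m) s ≤ ε * Metric.ediam s ^ d := by
          -- `s` need not be measurable; its closure is, and has the same diameter.
          calc μ.restrict (S m) s ≤ μ.restrict (S m) (closure s) := measure_mono subset_closure
            _ = μ (closure s ∩ S m) := Measure.restrict_apply isClosed_closure.measurableSet
            _ ≤ ε * Metric.ediam s ^ d := by
              rcases (closure s ∩ S m).eq_empty_or_nonempty with he | ⟨x, hx, hxS⟩
              · rw [he, measure_empty]; exact zero_le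
              · refine (measure_mono ?_).trans (hxS _ hs)
                intro y hy
                rw [Metric.mem_closedEBall, ← Metric.ediam_closure]
                exact Metric.edist_le_ediam_of_mem hy.1 hx
        rw [Measure.smul_apply, smul_eq_mul, mul_comm, ← div_eq_mul_inv]
        exact ENNReal.div_le_of_le_mul' h2
      have h3 := h1 A
      rw [Measure.smul_apply, smul_eq_mul, mul_comm, ← div_eq_mul_inv,
        ENNReal.div_le_iff hε0 ENNReal.coe_ne_top, mul_comm] at h3
      exact (Measure.le_restrict_apply _ _).trans h3
    calc μ A ≤ μ (⋃ m, A ∩ S m) := by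
          rw [← inter_iUnion]
          refine measure_mono_ae ?_
          filter_upwards [hfull] with x hx hxA using ⟨hxA, hx⟩
      _ = ⨆ m, μ (A ∩ S m) :=
          Monotone.measure_iUnion fun m m' hmm => inter_subset_inter_right _ (hS hmm)
      _ ≤ _ := iSup_le hle
  rw [← nonpos_iff_eq_zero]
  refine ENNReal.le_of_forall_pos_le_add fun ε hε _ => ?_
  lift μH[d] A to ℝ≥0 using hA with K
  rw [zero_add]
  refine (key (ε / (K + 1)) (by positivity)).trans ?_
  have : ε / (K + 1) * K ≤ ε := by
    rw [div_mul_eq_mul_div, div_le_iff₀ (by positivity)]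
    gcongr; simp
  exact_mod_cast this

instance isProbabilityMeasure_cubeMeasure (k : ℕ) : IsProbabilityMeasure (cubeMeasure k) :=
  ⟨cubeMeasure_univ k⟩

instance isFiniteMeasure_occupationMeasure {k n : ℕ} (X : unitCube k → EuclideanSpace ℝ (Fin n)) :
    IsFiniteMeasure (occupationMeasure X) := by
  unfold occupationMeasure; infer_instance

/-- A finite measure of finite Riesz energy of order `α` does not charge sets of finite
`(n - α)`-dimensional Hausdorff measure. -/
theorem measure_eq_zero_of_rieszEnergy_lt_top {n : ℕ} {α : ℝ} (hα : α < n)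
    {μ : Measure (EuclideanSpace ℝ (Fin n))} [IsFiniteMeasure μ] (hμ : rieszEnergy α μ < ∞)
    {A : Set (EuclideanSpace ℝ (Fin n))} (hA : μH[(n : ℝ) - α] A ≠ ∞) : μ A = 0 := by
  have hd : 0 < (n : ℝ) - α := by linarith
  refine measure_eq_zero_of_hausdorffMeasure_ne_top ?_ hA
  have hk : Measurable fun p : EuclideanSpace ℝ (Fin n) × EuclideanSpace ℝ (Fin n) =>
      rieszKernel α (p.1 - p.2) := by
    unfold rieszKernel
    fun_prop
  have hae : ∀ᵐ x ∂μ, rieszPotential α μ x < ∞ :=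
    ae_lt_top (hk.lintegral_prod_right') hμ.ne
  filter_upwards [hae] with x hx ε hε
  refine exists_measure_closedEBall_le_of_lintegral_edist_rpow hd ?_ hε
  simpa [rieszPotential, rieszKernel, edist_eq_enorm_sub] using hx.ne

/-! ### The cube, the Hölder ball and the upper Hausdorff bound -/

theorem measurableSet_unitCube (k : ℕ) : MeasurableSet (unitCube k) := by
  have : unitCube k = ⋂ i, (fun t : EuclideanSpace ℝ (Fin k) => t i) ⁻¹' Icc 0 1 := by
    ext t; simp [unitCube]
  rw [this]
  exact MeasurableSet.iInter fun i => measurableSet_Icc.preimage (by fun_prop)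

theorem cubeMeasure_preimage_pos {k : ℕ} {R : Set (EuclideanSpace ℝ (Fin k))}
    (hR : IsRectangle R) (hRc : R ⊆ unitCube k) :
    0 < cubeMeasure k (Subtype.val ⁻¹' R) := by
  obtain ⟨J, hJ, rfl⟩ := hR
  have hab : ∀ i, ∃ a b, a < b ∧ Icc a b ⊆ J i := by
    intro i
    obtain ⟨a, ha, b, hb, hab⟩ := (hJ i).2.exists_lt
    exact ⟨a, b, hab, (hJ i).1.out ha hb⟩
  choose a b hlt hsub using hab
  rw [cubeMeasure, comap_subtype_coe_apply (measurableSet_unitCube k),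
    Subtype.image_preimage_coe, inter_eq_right.2 hRc]
  have hpos : 0 < volume (Icc a b) := by
    rw [Real.volume_Icc_pi]
    exact pos_iff_ne_zero.2 (Finset.prod_ne_zero_iff.2 fun i _ => by simpa using hlt i)
  rw [← (EuclideanSpace.volume_preserving_symm_measurableEquiv_toLp (Fin k)).measure_preimage
    measurableSet_Icc.nullMeasurableSet] at hpos
  refine hpos.trans_le (measure_mono fun t ht i => hsub i ?_)
  exact ⟨ht.1 i, ht.2 i⟩

theorem holderWith_of_dist_le {X Y : Type*} [PseudoMetricSpace X] [PseudoMetricSpace Y]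
    {f : X → Y} {C r : ℝ≥0} (h : ∀ x y, dist (f x) (f y) ≤ C * dist x y ^ (r : ℝ)) :
    HolderWith C r f := by
  intro x y
  have := ENNReal.ofReal_le_ofReal (h x y)
  rwa [ENNReal.ofReal_mul (p := (C : ℝ)) C.coe_nonneg,
    ← ENNReal.ofReal_rpow_of_nonneg dist_nonneg r.coe_nonneg,
    ← edist_dist, ← edist_dist, ENNReal.ofReal_coe_nnreal] at this

theorem holderWith_of_mem_holderBall {k n : ℕ} {γ ρ : ℝ≥0}
    {X : unitCube k → EuclideanSpace ℝ (Fin n)} (hX : X ∈ holderBall k n γ ρ) :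
    HolderWith ρ γ X := by
  have h1 : MemHolder γ X := eHolderNorm_lt_top.1 (hX.2.trans_lt ENNReal.coe_lt_top)
  have h2 : nnHolderNorm γ X ≤ ρ := by
    rw [← ENNReal.coe_le_coe, h1.coe_nnHolderNorm_eq_eHolderNorm]; exact hX.2
  intro s t
  refine (h1.holderWith s t).trans ?_
  gcongr

theorem mem_holderBall_iff {k n : ℕ} {γ ρ : ℝ≥0} {X : unitCube k → EuclideanSpace ℝ (Fin n)} :
    X ∈ holderBall k n γ ρ ↔ X ⟨0, zero_mem_unitCube k⟩ = 0 ∧ HolderWith ρ γ X :=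
  ⟨fun h => ⟨h.1, holderWith_of_mem_holderBall h⟩, fun h => ⟨h.1, h.2.eHolderNorm_le⟩⟩

theorem isCompact_unitCube (k : ℕ) : IsCompact (unitCube k) := by
  have : unitCube k = EuclideanSpace.equiv (Fin k) ℝ ⁻¹' Icc 0 1 := by
    ext t; simp [unitCube, Pi.le_def, forall_and]
  rw [this]
  exact (EuclideanSpace.equiv (Fin k) ℝ).toHomeomorph.isClosedEmbedding.isCompact_preimage
    isCompact_Icc

instance compactSpace_unitCube (k : ℕ) : CompactSpace (unitCube k) :=
  isCompact_iff_compactSpace.1 (isCompact_unitCube k)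

/-- If k/γ ≤ n, a γ-Hölder map turns finite k-dimensional measure into finite k/γ-dimensional
measure. Otherwise the image lies in a compact subset of ℝⁿ. Hausdorff measure in the full dimension
is finite on compact sets. -/
theorem hausdorffMeasure_image_lt_top {k n : ℕ} {γ ρ : ℝ≥0} (hγ : 0 < γ)
    {X : unitCube k → EuclideanSpace ℝ (Fin n)} (hX : HolderWith ρ γ X) (S : Set (unitCube k)) :
    μH[min ((k : ℝ) / γ) n] (X '' S) < ∞ := by
  have hγ' : (0 : ℝ) < γ := hγ
  rcases le_total ((k : ℝ) / γ) n with h | h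
  · rw [min_eq_left h]
    have hd : (0 : ℝ) ≤ (k : ℝ) / γ := by positivity
    refine ((hX.holderOnWith S).hausdorffMeasure_image_le hγ hd).trans_lt ?_
    refine ENNReal.mul_lt_top (ENNReal.rpow_lt_top_of_nonneg hd ENNReal.coe_ne_top) ?_
    rw [mul_div_cancel₀ _ hγ'.ne',
      ← (isometry_subtype_coe (s := unitCube k)).hausdorffMeasure_image (Or.inl (by positivity))]
    refine (measure_mono (Subtype.coe_image_subset _ S)).trans_lt ?_
    have := (isCompact_unitCube k).measure_lt_top (μ := μH[Module.finrank ℝ (EuclideanSpace ℝ (Fin k))])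
    simpa using this
  · rw [min_eq_right h]
    refine (measure_mono (image_subset_range X S)).trans_lt ?_
    have := (isCompact_range (hX.continuous hγ)).measure_lt_top
      (μ := μH[Module.finrank ℝ (EuclideanSpace ℝ (Fin n))])
    simpa using this

/-! ### Existence of a minimizer -/

open Filter Topology in
/-- Fatou's lemma for iterated integrals of a pointwise convergent sequence. -/
theorem lintegral_lintegral_le_liminf {T : Type*} [MeasurableSpace T] {μ : Measure T} [SFinite μ]
    {f : ℕ → T × T → ℝ≥0∞} {g : T → T → ℝ≥0∞} (hf : ∀ j, Measurable (f j))
    (hfg : ∀ t s, Tendsto (fun j => f j (t, s)) atTop (𝓝 (g t s))) :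
    ∫⁻ t, ∫⁻ s, g t s ∂μ ∂μ ≤ liminf (fun j => ∫⁻ t, ∫⁻ s, f j (t, s) ∂μ ∂μ) atTop :=
  calc ∫⁻ t, ∫⁻ s, g t s ∂μ ∂μ
      = ∫⁻ t, ∫⁻ s, liminf (fun j => f j (t, s)) atTop ∂μ ∂μ := by
        simp only [fun t s => (hfg t s).liminf_eq]
    _ ≤ ∫⁻ t, liminf (fun j => ∫⁻ s, f j (t, s) ∂μ) atTop ∂μ :=
        lintegral_mono fun t => lintegral_liminf_le fun j =>
          (hf j).comp measurable_prodMk_left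
    _ ≤ _ := lintegral_liminf_le fun j => (hf j).lintegral_prod_right'

open Filter Topology in
/-- Lower semicontinuity of the Riesz energy of occupation measures under pointwise convergence. -/
theorem rieszEnergy_occupationMeasure_le_of_tendsto {k n : ℕ} {α : ℝ}
    {X : ℕ → unitCube k → EuclideanSpace ℝ (Fin n)} {Y : unitCube k → EuclideanSpace ℝ (Fin n)}
    (hX : ∀ j, Measurable (X j)) (hXY : ∀ t, Tendsto (fun j => X j t) atTop (𝓝 (Y t)))
    {m : ℝ≥0∞}
    (hm : Tendsto (fun j => rieszEnergy α (occupationMeasure (X j))) atTop (𝓝 m)) :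
    rieszEnergy α (occupationMeasure Y) ≤ m := by
  have hY : Measurable Y := measurable_of_tendsto_metrizable hX (tendsto_pi_nhds.2 hXY)
  have hmeas : ∀ j, Measurable fun p : unitCube k × unitCube k =>
      ‖X j p.1 - X j p.2‖ₑ ^ (α - n) := by
    intro j; have := hX j; fun_prop
  simp only [rieszEnergy_occupationMeasure α _ (hX _)] at hm
  rw [rieszEnergy_occupationMeasure α Y hY, ← hm.liminf_eq]
  have hlim : ∀ t s, Tendsto (fun j => ‖X j t - X j s‖ₑ ^ (α - n)) atTop
      (𝓝 (‖Y t - Y s‖ₑ ^ (α - n))) := fun t s =>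
    (ENNReal.continuous_rpow_const.tendsto _).comp (((hXY t).sub (hXY s)).enorm)
  exact lintegral_lintegral_le_liminf hmeas hlim

-- Arzelà–Ascoli: the conditions are closed under pointwise limits, vanishing at 0 gives a common
-- bound, and the Hölder modulus gives equicontinuity.
open BoundedContinuousFunction in
theorem isCompact_setOf_mem_holderBall (k n : ℕ) {γ : ℝ≥0} (ρ : ℝ≥0) (hγ : 0 < γ) :
    IsCompact {f : unitCube k →ᵇ EuclideanSpace ℝ (Fin n) | ⇑f ∈ holderBall k n γ ρ} := by
  have hγ' : (0 : ℝ) < γ := hγ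
  set A := {f : unitCube k →ᵇ EuclideanSpace ℝ (Fin n) | ⇑f ∈ holderBall k n γ ρ} with hA
  have hdist : ∀ f ∈ A, ∀ s t, dist (f s) (f t) ≤ ρ * dist s t ^ (γ : ℝ) := fun f hf s t =>
    (holderWith_of_mem_holderBall hf).dist_le s t
  refine arzela_ascoli₂ (Metric.closedBall 0 (ρ * Metric.diam (univ : Set (unitCube k)) ^ (γ : ℝ)))
    (isCompact_closedBall _ _) A ?_ ?_ ?_
  · have hAe : A = {f | f ⟨0, zero_mem_unitCube k⟩ = 0} ∩
        ⋂ s, ⋂ t, {f | dist (f s) (f t) ≤ ρ * dist s t ^ (γ : ℝ)} := by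
      ext f
      simp only [hA, mem_ofPred_eq, mem_inter_iff, mem_iInter, mem_holderBall_iff]
      exact and_congr_right fun _ => ⟨fun h s t => h.dist_le s t, holderWith_of_dist_le⟩
    rw [hAe]
    refine IsClosed.inter (isClosed_eq (continuous_eval_const _) continuous_const) ?_
    exact isClosed_iInter fun s => isClosed_iInter fun t =>
      isClosed_le ((continuous_eval_const s).dist (continuous_eval_const t)) continuous_const
  · intro f x hf
    have h := hdist f hf x ⟨0, zero_mem_unitCube k⟩
    rw [hf.1] at h
    refine h.trans ?_
    gcongr
    exact Metric.dist_le_diam_of_mem isCompact_univ.isBounded (mem_univ _) (mem_univ _)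
  · refine Metric.equicontinuous_of_continuity_modulus (fun r => ρ * r ^ (γ : ℝ)) ?_ _
      fun s t f => hdist f.1 f.2 s t
    have : Continuous fun r : ℝ => (ρ : ℝ) * r ^ (γ : ℝ) :=
      continuous_const.mul (Real.continuous_rpow_const hγ'.le)
    simpa [hγ'.ne'] using this.tendsto 0

theorem zero_mem_holderBall (k n : ℕ) (γ ρ : ℝ≥0) :
    (fun _ => 0 : unitCube k → EuclideanSpace ℝ (Fin n)) ∈ holderBall k n γ ρ :=
  mem_holderBall_iff.2 ⟨rfl, fun s t => by simp⟩

open Filter Topology BoundedContinuousFunction in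
theorem exists_isMinOn_rieszEnergy (k n : ℕ) (α : ℝ) {γ : ℝ≥0} (ρ : ℝ≥0) (hγ : 0 < γ) :
    ∃ X ∈ holderBall k n γ ρ,
      IsMinOn (fun Y => rieszEnergy α (occupationMeasure Y)) (holderBall k n γ ρ) X := by
  set F := fun Y : unitCube k → EuclideanSpace ℝ (Fin n) => rieszEnergy α (occupationMeasure Y)
  obtain ⟨u, -, hu, huF⟩ := exists_seq_tendsto_sInf (S := F '' holderBall k n γ ρ)
    ⟨_, mem_image_of_mem F (zero_mem_holderBall k n γ ρ)⟩ (OrderBot.bddBelow _)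
  choose X hX hXu using huF
  have hc : ∀ j, Continuous (X j) := fun j => (holderWith_of_mem_holderBall (hX j)).continuous hγ
  obtain ⟨f, hf, φ, hφ, hlim⟩ := (isCompact_setOf_mem_holderBall k n ρ hγ).tendsto_subseq
    (x := fun j => mkOfCompact ⟨X j, hc j⟩) hX
  refine ⟨f, hf, fun Y hY => ?_⟩
  have h1 : F f ≤ sInf (F '' holderBall k n γ ρ) := by
    refine rieszEnergy_occupationMeasure_le_of_tendsto (X := fun j => X (φ j))
      (fun j => (hc _).measurable) (fun t => ?_) ?_
    · exact ((continuous_eval_const (x := t)).tendsto f).comp hlim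
    · have := hu.comp hφ.tendsto_atTop
      simpa only [Function.comp_def, ← hXu] using this
  exact h1.trans (sInf_le (mem_image_of_mem F hY))

/-! ### Bounded potentials of Lebesgue measure -/

/-- In polar coordinates the integrand becomes r^(d-1-σ) on (0,1), with d the dimension. -/
theorem setLIntegral_ball_enorm_rpow_neg_lt_top {E : Type*} [NormedAddCommGroup E]
    [NormedSpace ℝ E] [FiniteDimensional ℝ E] [MeasurableSpace E] [BorelSpace E] [Nontrivial E]
    (μ : Measure E) [μ.IsAddHaarMeasure] {σ : ℝ} (hσ : σ < Module.finrank ℝ E) :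
    ∫⁻ y in Metric.ball (0 : E) 1, ‖y‖ₑ ^ (-σ) ∂μ < ∞ := by
  have hint : IntegrableOn (fun x : E => ‖x‖ ^ (-σ)) (Metric.ball (0 : E) 1) μ := by
    rw [integrableOn_fun_norm_addHaar μ (f := fun r => r ^ (-σ))]
    refine ((intervalIntegral.integrableOn_Ioo_rpow_iff (t := 1)
      (s := (Module.finrank ℝ E : ℝ) - 1 - σ) one_pos).2 (by linarith)).congr_fun ?_
      measurableSet_Ioo
    intro r hr
    have : 1 ≤ Module.finrank ℝ E := Module.finrank_pos
    simp only [smul_eq_mul]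
    rw [← Real.rpow_natCast, ← Real.rpow_add hr.1]
    congr 1
    push_cast [this]
    ring
  refine lt_of_le_of_lt (le_of_eq ?_) hint.2
  refine lintegral_congr_ae (ae_restrict_of_ae ?_)
  filter_upwards [compl_mem_ae_iff.2 (measure_singleton (μ := μ) (0 : E))] with y hy
  have hy' : 0 < ‖y‖ := norm_pos_iff.2 hy
  rw [← ofReal_norm, ENNReal.ofReal_rpow_of_pos hy', Real.enorm_eq_ofReal (by positivity)]

/-- Riesz potentials of Lebesgue measure on the cube are uniformly bounded. -/
theorem exists_lintegral_cubeMeasure_enorm_sub_rpow_neg_le {m : ℕ} {σ : ℝ} (hσ0 : 0 < σ)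
    (hσ : σ < m) :
    ∃ C : ℝ≥0, ∀ a : EuclideanSpace ℝ (Fin m),
      ∫⁻ x : unitCube m, ‖(x : EuclideanSpace ℝ (Fin m)) - a‖ₑ ^ (-σ) ∂cubeMeasure m ≤ C := by
  have hm : 0 < m := by
    have : (0 : ℝ) < m := hσ0.trans hσ
    exact_mod_cast this
  have : Nonempty (Fin m) := ⟨⟨0, hm⟩⟩
  set g : EuclideanSpace ℝ (Fin m) → ℝ≥0∞ := fun y => ‖y‖ₑ ^ (-σ)
  have hg : Measurable g := by fun_prop
  have hfin : ∫⁻ y in Metric.ball 0 1, g y < ∞ :=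
    setLIntegral_ball_enorm_rpow_neg_lt_top volume (by simpa using hσ)
  lift ∫⁻ y in Metric.ball 0 1, g y to ℝ≥0 using hfin.ne with K hK
  -- `K` bounds the part within distance 1 of `a`; farther away the kernel is at most 1 and the cube
  -- has mass 1.
  refine ⟨K + 1, fun a => ?_⟩
  have hle : ∀ y, g y ≤ (Metric.ball 0 1).indicator g y + 1 := by
    intro y
    by_cases hy : y ∈ Metric.ball 0 1
    · simp [hy]
    · rw [indicator_of_notMem hy, zero_add]
      have : 1 ≤ ‖y‖ₑ := by
        rw [← ofReal_norm, ENNReal.one_le_ofReal]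
        simpa using hy
      simp only [g]
      rw [ENNReal.rpow_neg, ENNReal.inv_le_one]
      exact ENNReal.one_le_rpow this hσ0
  have h1 : ∫⁻ x : unitCube m, (Metric.ball 0 1).indicator g (x - a) ∂cubeMeasure m ≤ K := by
    rw [cubeMeasure, lintegral_subtype_comap (measurableSet_unitCube m)
      (fun x => (Metric.ball 0 1).indicator g (x - a))]
    refine (setLIntegral_le_lintegral _ _).trans ?_
    rw [lintegral_sub_right_eq_self (fun x => (Metric.ball 0 1).indicator g x) a,
      lintegral_indicator Metric.isOpen_ball.measurableSet, hK]
  calc ∫⁻ x : unitCube m, g (x - a) ∂cubeMeasure m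
      ≤ ∫⁻ x : unitCube m, ((Metric.ball 0 1).indicator g (x - a) + 1) ∂cubeMeasure m :=
        lintegral_mono fun x => hle _
    _ = ∫⁻ x : unitCube m, (Metric.ball 0 1).indicator g (x - a) ∂cubeMeasure m + 1 := by
        rw [lintegral_add_right _ measurable_const, lintegral_one, cubeMeasure_univ]
    _ ≤ _ := by push_cast; gcongr

/-! ### Resampling and elementary inequalities -/

open Function in
/-- Resampling one coordinate of a product measure does not change it. -/
theorem lintegral_infinitePi_update {ι Y : Type*} [DecidableEq ι] [MeasurableSpace Y]
    (μ : Measure Y) [IsProbabilityMeasure μ] (j : ι) {f : (ι → Y) → ℝ≥0∞} (hf : Measurable f) :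
    ∫⁻ ω, f ω ∂Measure.infinitePi (fun _ : ι => μ) =
      ∫⁻ ω, ∫⁻ z, f (update ω j z) ∂μ ∂Measure.infinitePi (fun _ : ι => μ) := by
  set P := Measure.infinitePi (fun _ : ι => μ) with hP
  have hu : Measurable fun p : (ι → Y) × Y => update p.1 j p.2 := by
    refine measurable_pi_lambda _ fun i => ?_
    by_cases h : i = j
    · subst h; simpa using measurable_snd
    · simp only [update_of_ne h]; fun_prop
  have hmap : (P.prod μ).map (fun p : (ι → Y) × Y => update p.1 j p.2) = P := by
    refine Measure.eq_infinitePi _ fun s t ht => ?_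
    rw [Measure.map_apply hu (MeasurableSet.pi s.countable_toSet fun i _ => ht i)]
    by_cases hj : j ∈ s
    · have : (fun p : (ι → Y) × Y => update p.1 j p.2) ⁻¹' (Set.pi s t) =
          (Set.pi (s.erase j) t) ×ˢ t j := by
        ext ⟨ω, z⟩
        simp only [mem_preimage, Set.mem_pi, mem_prod, Finset.mem_coe, Finset.mem_erase]
        constructor
        · exact fun h => ⟨fun i hi => by simpa [hi.1] using h i hi.2, by simpa using h j hj⟩
        · rintro ⟨h1, h2⟩ i hi
          by_cases hij : i = j
          · subst hij; simpa using h2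
          · simpa [hij] using h1 i ⟨hij, hi⟩
      rw [this, Measure.prod_prod, hP, Measure.infinitePi_pi _ fun i _ => ht i,
        Finset.prod_erase_mul _ _ hj]
    · have : (fun p : (ι → Y) × Y => update p.1 j p.2) ⁻¹' (Set.pi s t) =
          (Set.pi s t) ×ˢ univ := by
        ext ⟨ω, z⟩
        simp only [mem_preimage, Set.mem_pi, mem_prod, Finset.mem_coe, mem_univ, and_true]
        refine forall₂_congr fun i hi => ?_
        rw [update_of_ne (by rintro rfl; exact hj hi)]
      rw [this, Measure.prod_prod, hP, Measure.infinitePi_pi _ fun i _ => ht i, measure_univ,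
        mul_one]
  conv_lhs => rw [← hmap]
  rw [lintegral_map hf hu, lintegral_prod (fun p : (ι → Y) × Y => f (update p.1 j p.2)) (hf.comp hu).aemeasurable]

theorem enorm_smul_rpow {E : Type*} [NormedAddCommGroup E] [NormedSpace ℝ E] (a : ℝ)
    (v : E) (r : ℝ) : ‖a • v‖ₑ ^ r = ‖a‖ₑ ^ r * ‖v‖ₑ ^ r := by
  rw [enorm_smul, ENNReal.mul_rpow_of_ne_top enorm_ne_top enorm_ne_top]

/-- The squared chord 2 - 2cos(u-v) is at least 8/9 = 2(2/3)², because cos 1 ≤ 5/9. Using both sine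
and cosine waves avoids the zeros of either increment. -/
theorem abs_cos_sub_cos_or_abs_sin_sub_sin_ge {u v : ℝ} (h1 : 1 ≤ |u - v|) (h2 : |u - v| ≤ 2) :
    2 / 3 ≤ |Real.cos u - Real.cos v| ∨ 2 / 3 ≤ |Real.sin u - Real.sin v| := by
  have hc : Real.cos (u - v) ≤ 5 / 9 := by
    rw [← Real.cos_abs]
    refine le_trans ?_ Real.cos_one_le
    exact Real.cos_le_cos_of_nonneg_of_le_pi zero_le_one (by linarith [Real.pi_gt_three]) h1
  rw [Real.cos_sub] at hc
  by_contra! h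
  have ha := sq_lt_sq' (by linarith [abs_nonneg (Real.cos u - Real.cos v)]) h.1
  have hb := sq_lt_sq' (by linarith [abs_nonneg (Real.sin u - Real.sin v)]) h.2
  rw [sq_abs] at ha hb
  nlinarith [Real.sin_sq_add_cos_sq u, Real.sin_sq_add_cos_sq v]

theorem min_two_le_two_mul_rpow {u γ : ℝ} (hu : 0 ≤ u) (hγ0 : 0 ≤ γ) (hγ : γ ≤ 1) :
    min 2 u ≤ 2 * u ^ γ := by
  rcases le_total u 1 with h | h
  · have := Real.rpow_le_rpow_of_exponent_ge' hu h hγ0 hγ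
    rw [Real.rpow_one] at this
    exact (min_le_right _ _).trans (by linarith)
  · have := Real.one_le_rpow h hγ0
    exact (min_le_left _ _).trans (by linarith)

theorem EuclideanSpace.exists_norm_le_card_mul_abs {k : ℕ} (hk : 0 < k)
    (x : EuclideanSpace ℝ (Fin k)) : ∃ i, ‖x‖ ≤ k * |x i| := by
  have : Nonempty (Fin k) := ⟨⟨0, hk⟩⟩
  obtain ⟨i, hi⟩ := Finite.exists_max fun i => |x i|
  refine ⟨i, ?_⟩
  have hk1 : (1 : ℝ) ≤ k := by exact_mod_cast hk
  rw [EuclideanSpace.norm_eq]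
  refine Real.sqrt_le_iff.2 ⟨by positivity, ?_⟩
  calc ∑ j, ‖x j‖ ^ 2 ≤ ∑ _j : Fin k, |x i| ^ 2 := by
        gcongr with j; exact hi j
    _ = k * |x i| ^ 2 := by simp
    _ ≤ k ^ 2 * |x i| ^ 2 := by gcongr; nlinarith
    _ = _ := by ring

/-! ### Random series with coefficients in the cube -/

/-- The function series `∑ p, φ p • ω p` with coefficients in the unit cube of `ℝⁿ`. -/
noncomputable def cubeSeries {ι T : Type*} {n : ℕ} (φ : ι → T → ℝ) (ω : ι → unitCube n) (t : T) :
    EuclideanSpace ℝ (Fin n) :=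
  ∑' p, φ p t • (ω p : EuclideanSpace ℝ (Fin n))

theorem exists_pos_norm_le_unitCube (n : ℕ) : ∃ M > 0, ∀ x ∈ unitCube n, ‖x‖ ≤ M :=
  (isCompact_unitCube n).isBounded.exists_pos_norm_le

theorem norm_smul_unitCube_le {n : ℕ} {M : ℝ} (hM : ∀ x ∈ unitCube n, ‖x‖ ≤ M) {a b : ℝ}
    (hab : |a| ≤ b) (x : unitCube n) : ‖a • (x : EuclideanSpace ℝ (Fin n))‖ ≤ b * M := by
  rw [norm_smul]
  exact mul_le_mul hab (hM _ x.2) (norm_nonneg _) ((abs_nonneg a).trans hab)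

section CubeSeries

variable {ι T : Type*} {n : ℕ} {φ : ι → T → ℝ} {b : ι → ℝ}

theorem summable_smul_unitCube {a b : ι → ℝ} (hab : ∀ p, |a p| ≤ b p) (hb : Summable b)
    (ω : ι → unitCube n) : Summable fun p => a p • (ω p : EuclideanSpace ℝ (Fin n)) := by
  obtain ⟨M, -, hM⟩ := exists_pos_norm_le_unitCube n
  exact .of_norm_bounded (hb.mul_right M) fun p => norm_smul_unitCube_le hM (hab p) _

theorem continuous_cubeSeries [TopologicalSpace T] (hφ : ∀ p t, |φ p t| ≤ b p) (hb : Summable b)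
    (hc : ∀ p, Continuous (φ p)) :
    Continuous fun q : (ι → unitCube n) × T => cubeSeries φ q.1 q.2 := by
  obtain ⟨M, -, hM⟩ := exists_pos_norm_le_unitCube n
  refine continuous_tsum (fun p => ?_) (hb.mul_right M)
    fun p q => norm_smul_unitCube_le hM (hφ p q.2) _
  have := hc p
  fun_prop

theorem dist_cubeSeries_le {M : ℝ} (hM : ∀ x ∈ unitCube n, ‖x‖ ≤ M) (hφ : ∀ p t, |φ p t| ≤ b p)
    (hb : Summable b) {D : ℝ} {c : ι → ℝ} (hc : Summable c) {t s : T}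
    (hd : ∀ p, |φ p t - φ p s| ≤ c p * D) (ω : ι → unitCube n) :
    dist (cubeSeries φ ω t) (cubeSeries φ ω s) ≤ (∑' p, c p) * M * D := by
  rw [dist_eq_norm, cubeSeries, cubeSeries, ← (summable_smul_unitCube (fun p => hφ p t) hb ω).tsum_sub
    (summable_smul_unitCube (fun p => hφ p s) hb ω)]
  have : ∀ p, ‖φ p t • (ω p : EuclideanSpace ℝ (Fin n)) - φ p s • (ω p : EuclideanSpace ℝ (Fin n))‖
      ≤ c p * (M * D) := by
    intro p
    rw [← sub_smul]
    exact (norm_smul_unitCube_le hM (hd p) _).trans (by apply le_of_eq; ring)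
  refine (tsum_of_norm_bounded (hc.mul_right (M * D)).hasSum this).trans ?_
  rw [tsum_mul_right, mul_assoc]

theorem cubeSeries_update [DecidableEq ι] (hφ : ∀ p t, |φ p t| ≤ b p) (hb : Summable b)
    (ω : ι → unitCube n) (p : ι) (z : unitCube n) (t : T) :
    cubeSeries φ (Function.update ω p z) t = φ p t • (z : EuclideanSpace ℝ (Fin n)) +
      ∑' q, if q = p then 0 else φ q t • (ω q : EuclideanSpace ℝ (Fin n)) := by
  rw [cubeSeries, (summable_smul_unitCube (fun p => hφ p t) hb _).tsum_eq_add_tsum_ite p]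
  congr 1
  · simp
  · refine tsum_congr fun q => ?_
    split_ifs with h
    · rfl
    · rw [Function.update_of_ne h]

/-- For coefficients drawn independently and uniformly from the unit cube, the negative moments of
the increments of the series are controlled by the increments of any single term. -/
theorem lintegral_enorm_cubeSeries_sub_rpow_neg_le [Countable ι] (hφ : ∀ p t, |φ p t| ≤ b p)
    (hb : Summable b) {σ : ℝ} {C : ℝ≥0}
    (hC : ∀ a : EuclideanSpace ℝ (Fin n),
      ∫⁻ x : unitCube n, ‖(x : EuclideanSpace ℝ (Fin n)) - a‖ₑ ^ (-σ) ∂cubeMeasure n ≤ C)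
    (p : ι) {t s : T} (hts : φ p t ≠ φ p s) :
    ∫⁻ ω, ‖cubeSeries φ ω t - cubeSeries φ ω s‖ₑ ^ (-σ)
        ∂Measure.infinitePi (fun _ : ι => cubeMeasure n) ≤
      C * ‖φ p t - φ p s‖ₑ ^ (-σ) := by
  classical
  have hne : φ p t - φ p s ≠ 0 := sub_ne_zero.2 hts
  have hm : ∀ r : T, Measurable fun ω : ι → unitCube n => cubeSeries φ ω r := by
    intro r
    -- Only measurability in ω is needed here, so the discrete topology on `T` lets joint continuity
    -- be reused.
    let _ : TopologicalSpace T := ⊥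
    have : DiscreteTopology T := ⟨rfl⟩
    have := (continuous_cubeSeries (n := n) hφ hb fun p => continuous_of_discreteTopology).comp
      (Continuous.prodMk_left r)
    exact this.measurable
  have hm' : Measurable fun ω : ι → unitCube n =>
      ‖cubeSeries φ ω t - cubeSeries φ ω s‖ₑ ^ (-σ) :=
    ((hm t).sub (hm s)).enorm.pow_const _
  rw [lintegral_infinitePi_update (cubeMeasure n) p hm']
  calc _ ≤ ∫⁻ _ω, C * ‖φ p t - φ p s‖ₑ ^ (-σ) ∂Measure.infinitePi (fun _ : ι => cubeMeasure n) := by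
        refine lintegral_mono fun ω => ?_
        set a : T → EuclideanSpace ℝ (Fin n) := fun r =>
          ∑' q, if q = p then 0 else φ q r • (ω q : EuclideanSpace ℝ (Fin n))
        -- Factoring out the increment of term `p` leaves `z` minus a point independent of `z`,
        -- which is why `hC` must be uniform in its centre.
        have hz : ∀ z : unitCube n, cubeSeries φ (Function.update ω p z) t -
            cubeSeries φ (Function.update ω p z) s = (φ p t - φ p s) •
              ((z : EuclideanSpace ℝ (Fin n)) - (φ p t - φ p s)⁻¹ • (a s - a t)) := by
          intro z
          rw [cubeSeries_update hφ hb, cubeSeries_update hφ hb, smul_sub, smul_inv_smul₀ hne,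
            sub_smul]
          simp only [a]
          abel
        simp only [hz, enorm_smul_rpow]
        rw [lintegral_const_mul _ (by fun_prop), mul_comm]
        gcongr
        exact hC _
    _ = _ := by simp

end CubeSeries

/-! ### Lacunary waves -/

/-- The terms of a lacunary trigonometric series with frequencies `2 ^ j` and amplitudes
`c * θ ^ j` in each of the `k` coordinates. -/
noncomputable def lacunaryWave {k : ℕ} (c θ : ℝ) (p : ℕ × (Fin k × Bool)) (t : unitCube k) : ℝ :=
  c * θ ^ p.1 * cond p.2.2 (Real.cos (2 ^ p.1 * (t : EuclideanSpace ℝ (Fin k)) p.2.1) - 1)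
    (Real.sin (2 ^ p.1 * (t : EuclideanSpace ℝ (Fin k)) p.2.1))

section LacunaryWave

variable {k : ℕ} {c θ : ℝ}

theorem lacunaryWave_zero (p : ℕ × (Fin k × Bool)) :
    lacunaryWave c θ p ⟨0, zero_mem_unitCube k⟩ = 0 := by
  rcases p with ⟨j, i, _ | _⟩ <;> simp [lacunaryWave]

theorem continuous_lacunaryWave (p : ℕ × (Fin k × Bool)) :
    Continuous (lacunaryWave c θ p) := by
  change Continuous fun t => lacunaryWave c θ p t
  rcases p with ⟨j, i, _ | _⟩ <;> simp only [lacunaryWave, cond_true, cond_false] <;> fun_prop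

theorem abs_lacunaryWave_le (hc : 0 ≤ c) (hθ : 0 ≤ θ) (p : ℕ × (Fin k × Bool)) (t : unitCube k) :
    |lacunaryWave c θ p t| ≤ c * 2 * θ ^ p.1 := by
  have h : |lacunaryWave c θ p t| ≤ c * θ ^ p.1 * 2 := by
    rw [lacunaryWave, abs_mul, abs_of_nonneg (by positivity : 0 ≤ c * θ ^ p.1)]
    gcongr
    rcases p with ⟨j, i, _ | _⟩ <;> simp only [cond_true, cond_false] <;> rw [abs_le]
    · constructor <;> linarith [Real.neg_one_le_sin (2 ^ j * (t : EuclideanSpace ℝ (Fin k)) i),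
        Real.sin_le_one (2 ^ j * (t : EuclideanSpace ℝ (Fin k)) i)]
    · constructor <;> linarith [Real.neg_one_le_cos (2 ^ j * (t : EuclideanSpace ℝ (Fin k)) i),
        Real.cos_le_one (2 ^ j * (t : EuclideanSpace ℝ (Fin k)) i)]
  linarith

theorem summable_mul_pow_fst {α : Type*} [Finite α] (A : ℝ) {r : ℝ} (hr0 : 0 ≤ r) (hr : r < 1) :
    Summable fun p : ℕ × α => A * r ^ p.1 := by
  refine Summable.mul_left A ?_
  have := (summable_geometric_of_lt_one hr0 hr).mul_of_nonneg
    (Summable.of_finite (f := fun _ : α => (1 : ℝ))) (fun _ => by positivity)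
    (fun _ => zero_le_one)
  simpa using this

theorem abs_cos_sub_cos_le_min (u v : ℝ) : |Real.cos u - Real.cos v| ≤ min 2 |u - v| := by
  refine le_min ?_ ?_
  · rw [abs_le]
    constructor <;> linarith [Real.neg_one_le_cos u, Real.cos_le_one u, Real.neg_one_le_cos v,
      Real.cos_le_one v]
  · simpa [Real.dist_eq] using Real.lipschitzWith_cos.dist_le_mul u v

theorem abs_sin_sub_sin_le_min (u v : ℝ) : |Real.sin u - Real.sin v| ≤ min 2 |u - v| := by
  refine le_min ?_ ?_
  · rw [abs_le]
    constructor <;> linarith [Real.neg_one_le_sin u, Real.sin_le_one u, Real.neg_one_le_sin v,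
      Real.sin_le_one v]
  · simpa [Real.dist_eq] using Real.lipschitzWith_sin.dist_le_mul u v

/-- Interpolates between the trivial bound 2 and the Lipschitz bound. With θ = 2^(-H) and H > γ
these Hölder constants are summable. -/
theorem abs_lacunaryWave_sub_le (hc : 0 ≤ c) (hθ : 0 ≤ θ) {γ : ℝ} (hγ0 : 0 ≤ γ) (hγ : γ ≤ 1)
    (p : ℕ × (Fin k × Bool)) (t s : unitCube k) :
    |lacunaryWave c θ p t - lacunaryWave c θ p s| ≤ c * 2 * (θ * 2 ^ γ) ^ p.1 * dist t s ^ γ := by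
  obtain ⟨j, i, e⟩ := p
  set u := 2 ^ j * (t : EuclideanSpace ℝ (Fin k)) i with hu
  set v := 2 ^ j * (s : EuclideanSpace ℝ (Fin k)) i with hv
  have h1 : |lacunaryWave c θ (j, i, e) t - lacunaryWave c θ (j, i, e) s| ≤
      c * θ ^ j * min 2 |u - v| := by
    simp only [lacunaryWave]
    rw [← mul_sub, abs_mul, abs_of_nonneg (by positivity : 0 ≤ c * θ ^ j)]
    gcongr
    cases e
    · exact abs_sin_sub_sin_le_min u v
    · simpa using abs_cos_sub_cos_le_min u v
  have h2 : |u - v| ≤ 2 ^ j * dist t s := by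
    rw [hu, hv, ← mul_sub, abs_mul, abs_of_nonneg (by positivity : (0 : ℝ) ≤ 2 ^ j)]
    gcongr
    rw [Subtype.dist_eq, dist_eq_norm]
    exact PiLp.norm_apply_le ((t : EuclideanSpace ℝ (Fin k)) - (s : EuclideanSpace ℝ (Fin k))) i
  calc _ ≤ c * θ ^ j * min 2 |u - v| := h1
    _ ≤ c * θ ^ j * (2 * |u - v| ^ γ) := by
        gcongr; exact min_two_le_two_mul_rpow (abs_nonneg _) hγ0 hγ
    _ ≤ c * θ ^ j * (2 * (2 ^ j * dist t s) ^ γ) := by gcongr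
    _ = _ := by
        rw [Real.mul_rpow (by positivity) dist_nonneg, ← Real.rpow_natCast 2 j,
          ← Real.rpow_mul two_pos.le, mul_comm (j : ℝ), Real.rpow_mul two_pos.le,
          Real.rpow_natCast, mul_pow]
        ring

theorem exists_le_abs_lacunaryWave_sub (hk : 0 < k) (hc : 0 ≤ c) {H : ℝ} (hH : 0 ≤ H)
    {t s : unitCube k} (hts : t ≠ s) :
    ∃ p, c * (2 / 3) * (2 * k : ℝ) ^ (-H) * dist t s ^ H ≤
      |lacunaryWave c (2 ^ (-H)) p t - lacunaryWave c (2 ^ (-H)) p s| := by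
  obtain ⟨i, hi⟩ := EuclideanSpace.exists_norm_le_card_mul_abs hk
    ((t : EuclideanSpace ℝ (Fin k)) - s)
  rw [← dist_eq_norm, ← Subtype.dist_eq] at hi
  set d := |((t : EuclideanSpace ℝ (Fin k)) - s) i| with hd
  have hk' : (0 : ℝ) < k := by exact_mod_cast hk
  have hdist : 0 < dist t s := dist_pos.2 hts
  have hd0 : 0 < d := pos_of_mul_pos_right (hdist.trans_le hi) hk'.le
  have hd1 : d ≤ 1 := by
    have h1 := t.2 i
    have h2 := s.2 i
    rw [hd, PiLp.sub_apply, abs_le]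
    constructor <;> linarith [h1.1, h1.2, h2.1, h2.2]
  -- The frequency 2^(m+1) puts the phase difference 2^(m+1) d in (1, 2], where sine or cosine must
  -- move.
  obtain ⟨m, hm1, hm2⟩ := exists_nat_pow_near ((one_le_div hd0).2 hd1) one_lt_two
  rw [le_div_iff₀ hd0] at hm1
  rw [div_lt_iff₀ hd0] at hm2
  set j := m + 1
  have hj : (2 : ℝ) ^ j = 2 * 2 ^ m := pow_succ' 2 m
  set u := 2 ^ j * (t : EuclideanSpace ℝ (Fin k)) i with hu
  set v := 2 ^ j * (s : EuclideanSpace ℝ (Fin k)) i with hv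
  have huv : |u - v| = 2 ^ j * d := by
    rw [hu, hv, ← mul_sub, abs_mul, abs_of_nonneg (by positivity : (0 : ℝ) ≤ 2 ^ j), hd,
      PiLp.sub_apply]
  have hamp : (2 * k : ℝ) ^ (-H) * dist t s ^ H ≤ ((2 : ℝ) ^ (-H)) ^ j := by
    calc (2 * k : ℝ) ^ (-H) * dist t s ^ H = (dist t s / (2 * k)) ^ H := by
          rw [Real.div_rpow hdist.le (by positivity), Real.rpow_neg (by positivity)]
          field_simp
      _ ≤ ((2 ^ j : ℝ)⁻¹) ^ H := by
          gcongr
          rw [div_le_iff₀ (by positivity), inv_mul_eq_div, le_div_iff₀ (by positivity), hj]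
          nlinarith [pow_pos (two_pos : (0 : ℝ) < 2) m]
      _ = ((2 : ℝ) ^ (-H)) ^ j := by
          rw [Real.inv_rpow (by positivity), ← Real.rpow_neg (by positivity),
            ← Real.rpow_natCast, ← Real.rpow_natCast, ← Real.rpow_mul two_pos.le,
            ← Real.rpow_mul two_pos.le, mul_comm]
  have hfin : ∀ x : ℝ, 2 / 3 ≤ |x| →
      c * (2 / 3) * (2 * k : ℝ) ^ (-H) * dist t s ^ H ≤ |c * ((2 : ℝ) ^ (-H)) ^ j * x| := by
    intro x hx
    rw [abs_mul, abs_of_nonneg (by positivity : 0 ≤ c * ((2 : ℝ) ^ (-H)) ^ j)]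
    calc _ = c * ((2 * k : ℝ) ^ (-H) * dist t s ^ H) * (2 / 3) := by ring
      _ ≤ c * ((2 : ℝ) ^ (-H)) ^ j * |x| := by gcongr
  rcases abs_cos_sub_cos_or_abs_sin_sub_sin_ge (u := u) (v := v) (by rw [huv]; exact hm2.le)
    (by rw [huv, hj]; linarith) with h | h
  · refine ⟨(j, i, true), (hfin _ h).trans (le_of_eq ?_)⟩
    simp only [lacunaryWave, cond_true]
    congr 1
    ring
  · refine ⟨(j, i, false), (hfin _ h).trans (le_of_eq ?_)⟩
    simp only [lacunaryWave, cond_false]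
    congr 1
    ring

end LacunaryWave

/-! ### A competitor of finite energy and the conclusion -/

/-- First moment method for a random double integral. -/
theorem exists_lintegral_lintegral_lt_top {Ω T : Type*} [MeasurableSpace Ω] [MeasurableSpace T]
    {P : Measure Ω} [IsProbabilityMeasure P] {μ : Measure T} [IsProbabilityMeasure μ]
    {F : (Ω × T) × T → ℝ≥0∞} (hF : Measurable F) {G : T → T → ℝ≥0∞}
    (hFG : ∀ t s, ∫⁻ ω, F ((ω, t), s) ∂P ≤ G t s) {K : ℝ≥0∞} (hG : ∀ t, ∫⁻ s, G t s ∂μ ≤ K)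
    (hK : K ≠ ∞) : ∃ ω, ∫⁻ t, ∫⁻ s, F ((ω, t), s) ∂μ ∂μ < ∞ := by
  have hm : Measurable fun q : Ω × T => ∫⁻ s, F (q, s) ∂μ := hF.lintegral_prod_right'
  obtain ⟨ω, hω⟩ := exists_le_lintegral (μ := P) (f := fun ω => ∫⁻ t, ∫⁻ s, F ((ω, t), s) ∂μ ∂μ)
    hm.lintegral_prod_right'.aemeasurable
  refine ⟨ω, hω.trans_lt ?_⟩
  rw [lintegral_lintegral_swap (f := fun ω t => ∫⁻ s, F ((ω, t), s) ∂μ) hm.aemeasurable]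
  refine lt_of_le_of_lt (lintegral_mono (g := fun _ => K) fun t => ?_)
    (by simpa using hK.lt_top)
  have hFt : Measurable fun q : Ω × T => F ((q.1, t), q.2) := by fun_prop
  beta_reduce
  rw [lintegral_lintegral_swap (f := fun ω s => F ((ω, t), s)) hFt.aemeasurable]
  exact (lintegral_mono fun s => hFG t s).trans (hG t)

theorem exists_mem_holderBall_rieszEnergy_lt_top {k n : ℕ} {α : ℝ} {γ ρ : ℝ≥0}
    (hα : 0 < α) (hαn : α < n) (hγ : 0 < γ) (hγ' : (γ : ℝ) < min ((k : ℝ) / (n - α)) 1)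
    (hρ : 0 < ρ) :
    ∃ X ∈ holderBall k n γ ρ, rieszEnergy α (occupationMeasure X) < ∞ := by
  have hσ0 : 0 < (n : ℝ) - α := by linarith
  have hγ0 : (0 : ℝ) < γ := hγ
  have hγ1 : (γ : ℝ) < 1 := hγ'.trans_le (min_le_right _ _)
  -- H > γ gives Hölder regularity, and H(n-α) < k gives integrable moments.
  obtain ⟨H, hγH, hHk⟩ := exists_between (hγ'.trans_le (min_le_left _ _))
  have hH0 : 0 < H := hγ0.trans hγH
  rw [lt_div_iff₀ hσ0] at hHk
  have hk : 0 < k := by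
    have : (0 : ℝ) < k := (mul_pos hH0 hσ0).trans hHk
    exact_mod_cast this
  have hk' : (0 : ℝ) < k := by exact_mod_cast hk
  obtain ⟨C, hC⟩ := exists_lintegral_cubeMeasure_enorm_sub_rpow_neg_le (m := n) hσ0 (by linarith)
  obtain ⟨C', hC'⟩ := exists_lintegral_cubeMeasure_enorm_sub_rpow_neg_le (m := k)
    (mul_pos hH0 hσ0) hHk
  obtain ⟨M, hM0, hM⟩ := exists_pos_norm_le_unitCube n
  set θ : ℝ := 2 ^ (-H)
  have hθ0 : 0 < θ := by positivity
  have hθ1 : θ < 1 := Real.rpow_lt_one_of_one_lt_of_neg one_lt_two (by linarith)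
  have hη0 : 0 < θ * 2 ^ (γ : ℝ) := by positivity
  have hη1 : θ * 2 ^ (γ : ℝ) < 1 := by
    rw [← Real.rpow_add two_pos]
    exact Real.rpow_lt_one_of_one_lt_of_neg one_lt_two (by linarith)
  set S : ℝ := ∑' p : ℕ × (Fin k × Bool), 2 * (θ * 2 ^ (γ : ℝ)) ^ p.1
  have hS : 0 ≤ S := tsum_nonneg fun p => by positivity
  have hρ' : (0 : ℝ) < ρ := hρ
  set c : ℝ := ρ / (S * M + 1)
  have hc : 0 < c := by positivity
  have hcS : c * S * M ≤ ρ := by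
    rw [show c * S * M = ρ * (S * M) / (S * M + 1) by simp only [c]; ring,
      div_le_iff₀ (by positivity)]
    nlinarith
  have hφ := abs_lacunaryWave_le (k := k) hc.le hθ0.le
  have hb : Summable fun p : ℕ × (Fin k × Bool) => c * 2 * θ ^ p.1 :=
    summable_mul_pow_fst _ hθ0.le hθ1
  have hmem : ∀ ω : ℕ × (Fin k × Bool) → unitCube n,
      cubeSeries (lacunaryWave c θ) ω ∈ holderBall k n γ ρ := by
    intro ω
    refine mem_holderBall_iff.2 ⟨by simp [cubeSeries, lacunaryWave_zero], ?_⟩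
    refine holderWith_of_dist_le fun t s => ?_
    refine (dist_cubeSeries_le hM hφ hb (summable_mul_pow_fst (c * 2) hη0.le hη1)
      (fun p => abs_lacunaryWave_sub_le hc.le hθ0.le hγ0.le hγ1.le p t s) ω).trans ?_
    gcongr
    have : ∑' p : ℕ × (Fin k × Bool), c * 2 * (θ * 2 ^ (γ : ℝ)) ^ p.1 = c * S := by
      simp only [S, mul_assoc c, tsum_mul_left]
    rwa [this]
  set P := Measure.infinitePi (fun _ : ℕ × (Fin k × Bool) => cubeMeasure n)
  set K : ℝ≥0 := (c * (2 / 3) * (2 * k : ℝ) ^ (-H)).toNNReal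
  have hK : 0 < K := Real.toNNReal_pos.2 (by positivity)
  have hmoment : ∀ t s : unitCube k,
      ∫⁻ ω, ‖cubeSeries (lacunaryWave c θ) ω t - cubeSeries (lacunaryWave c θ) ω s‖ₑ ^ (α - n) ∂P ≤
        (C + 1) * K ^ (α - n) *
          ‖(s : EuclideanSpace ℝ (Fin k)) - t‖ₑ ^ (-(H * (n - α))) := by
    intro t s
    have hK0 : (K : ℝ≥0∞) ^ (α - n) ≠ 0 := by
      rw [← ENNReal.coe_rpow_of_ne_zero hK.ne']
      exact_mod_cast (NNReal.rpow_pos hK).ne'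
    -- On the diagonal both sides should be infinite; the factor `C + 1` rather than `C` rules out 0
    -- · ∞ = 0.
    rcases eq_or_ne t s with rfl | hts
    · simp only [sub_self, enorm_zero]
      rw [ENNReal.zero_rpow_of_neg (by nlinarith : -(H * (n - α)) < 0), ENNReal.mul_top]
      · exact le_top
      · exact mul_ne_zero (by positivity) hK0
    · obtain ⟨p, hp⟩ := exists_le_abs_lacunaryWave_sub hk hc.le hH0.le hts
      have hne : lacunaryWave c θ p t ≠ lacunaryWave c θ p s := by
        rw [← sub_ne_zero, ← abs_pos]
        have := dist_pos.2 hts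
        exact lt_of_lt_of_le (by positivity) hp
      have h1 := lintegral_enorm_cubeSeries_sub_rpow_neg_le hφ hb hC p hne
      rw [neg_sub] at h1
      refine h1.trans ?_
      rw [mul_assoc]
      gcongr
      · exact le_self_add
      have h2 : (K : ℝ≥0∞) * ‖(s : EuclideanSpace ℝ (Fin k)) - t‖ₑ ^ H ≤
          ‖lacunaryWave c θ p t - lacunaryWave c θ p s‖ₑ := by
        have h3 := ENNReal.ofReal_le_ofReal hp
        rw [ENNReal.ofReal_mul (by positivity), ← ENNReal.ofReal_rpow_of_nonneg dist_nonneg hH0.le,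
          ← edist_dist, Subtype.edist_eq, edist_comm, edist_eq_enorm_sub] at h3
        rwa [Real.enorm_eq_ofReal_abs]
      rw [show -(H * (n - α)) = H * (α - n) by ring, ENNReal.rpow_mul, ← ENNReal.mul_rpow_of_ne_top
        ENNReal.coe_ne_top (ENNReal.rpow_ne_top_of_nonneg hH0.le enorm_ne_top),
        show α - n = -(n - α) by ring, ENNReal.rpow_neg, ENNReal.rpow_neg, ENNReal.inv_le_inv]
      gcongr
  have hF : Measurable fun q : ((ℕ × (Fin k × Bool) → unitCube n) × unitCube k) × unitCube k =>
      ‖cubeSeries (lacunaryWave c θ) q.1.1 q.1.2 -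
        cubeSeries (lacunaryWave c θ) q.1.1 q.2‖ₑ ^ (α - n) := by
    have h := (continuous_cubeSeries (n := n) hφ hb continuous_lacunaryWave).measurable
    exact (((h.comp (measurable_fst.fst.prodMk measurable_fst.snd)).sub
      (h.comp (measurable_fst.fst.prodMk measurable_snd))).enorm).pow_const _
  obtain ⟨ω, hω⟩ := exists_lintegral_lintegral_lt_top hF hmoment (K := (C + 1) * K ^ (α - n) * C')
    (fun t => by
      rw [lintegral_const_mul _ (by fun_prop)]
      gcongr
      exact hC' t) (by
      rw [← ENNReal.coe_rpow_of_ne_zero hK.ne']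
      exact_mod_cast ENNReal.coe_ne_top)
  refine ⟨_, hmem ω, ?_⟩
  rwa [rieszEnergy_occupationMeasure α _
    ((holderWith_of_mem_holderBall (hmem ω)).continuous hγ).measurable]

theorem theoremT (k n : ℕ) (α : ℝ) (γ ρ : ℝ≥0)
    (hα : 0 < α) (hαn : α < n)
    (hγ : 0 < γ) (hγ' : (γ : ℝ) < min ((k : ℝ) / (n - α)) 1) (hρ : 0 < ρ) :
    (∃ X ∈ holderBall k n γ ρ,
      IsMinOn (fun Y => rieszEnergy α (occupationMeasure Y)) (holderBall k n γ ρ) X ∧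
      rieszEnergy α (occupationMeasure X) < ∞) ∧
    (∀ X ∈ holderBall k n γ ρ,
      IsMinOn (fun Y => rieszEnergy α (occupationMeasure Y)) (holderBall k n γ ρ) X →
      ∀ R : Set (EuclideanSpace ℝ (Fin k)), IsRectangle R → R ⊆ unitCube k →
        Measure.hausdorffMeasure ((n : ℝ) - α) (X '' (Subtype.val ⁻¹' R)) = ∞ ∧
        Measure.hausdorffMeasure (min ((k : ℝ) / γ) n) (X '' (Subtype.val ⁻¹' R)) < ∞ ∧
        ENNReal.ofReal ((n : ℝ) - α) ≤ dimH (X '' (Subtype.val ⁻¹' R)) ∧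
        dimH (X '' (Subtype.val ⁻¹' R)) ≤ ENNReal.ofReal (min ((k : ℝ) / γ) n)) := by
  obtain ⟨Y, hY, hYfin⟩ := exists_mem_holderBall_rieszEnergy_lt_top hα hαn hγ hγ' hρ
  constructor
  · obtain ⟨X, hX, hmin⟩ := exists_isMinOn_rieszEnergy k n α ρ hγ
    exact ⟨X, hX, hmin, (hmin hY).trans_lt hYfin⟩
  · intro X hX hmin R hR hRc
    have hXh := holderWith_of_mem_holderBall hX
    have hXm : Measurable X := (hXh.continuous hγ).measurable
    have hlow : Measure.hausdorffMeasure ((n : ℝ) - α) (X '' (Subtype.val ⁻¹' R)) = ∞ := by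
      by_contra hne
      have h0 := measure_eq_zero_of_rieszEnergy_lt_top hαn ((hmin hY).trans_lt hYfin) hne
      -- The image may fail to be measurable, but the pushforward still gives it at least the mass
      -- of the rectangle.
      exact (cubeMeasure_preimage_pos hR hRc).ne' (le_antisymm
        ((Measure.le_map_apply_image hXm.aemeasurable _).trans h0.le) zero_le)
    have hup := hausdorffMeasure_image_lt_top hγ hXh (Subtype.val ⁻¹' R)
    refine ⟨hlow, hup, ?_, ?_⟩
    · refine le_dimH_of_hausdorffMeasure_eq_top ?_
      rwa [Real.coe_toNNReal _ (by linarith)]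
    · refine dimH_le_of_hausdorffMeasure_ne_top ?_
      rw [Real.coe_toNNReal _ (by positivity)]
      exact hup.ne
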